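/- Let $\alpha,\beta>0$ be real, $L\ge 1$ an integer, $\rho=\alpha/\beta$, and let $\rho\le\theta<1$. Let $\mathcal V$ be the set of real sequences $v=(v(k))_{k\ge 0}$ with $v(0)=1$, $v(k)\ge v(k+1)$ for all $k\ge 0$, and $\lim_{k\to\infty}v(k)=0$. For a sequence $x=(x(k))_{k\ge 0}$ put $\Vert x\Vert_{L_2(g_\theta)}=\bigl(\sum_{k\ge1}x(k)^2\theta^{-k}\bigr)^{1/2}$, let $L_2(g_\theta)$ be the space of sequences with $x(0)=0$ and $\Vert x\Vert_{L_2(g_\theta)}<\infty$, and let $\mathcal V\cap L_2(g_\theta)$ denote (by abuse of notation) the set of $v\in\mathcal V$ with $\sum_{k\ge1}v(k)^2\theta^{-k}<\infty$. Let $\tilde u\in\mathcal V$ be given by $\tilde u(0)=1$ and $\tilde u(k)=\rho^{L^{k-1}+L^{k-2}+\cdots+1}$ for $k\ge1$. Then there are constants $\gamma_\theta>0$ and $C_\theta<\infty$ (depending only on $\alpha,\beta,L,\theta$) such that for every solution $u=(u_t)_{t\ge0}$ with values in $\mathcal V$ of $$\dot u_t(k)=\alpha\bigl(u_t(k-1)^L-u_t(k)^L\bigr)-\beta\bigl(u_t(k)-u_t(k+1)\bigr),\qquad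 k\ge1,\ t\ge0,$$ such that $u_0\in\mathcal V\cap L_2(g_\theta)$, one has, for all $t\ge0$, $u_t-\tilde u\in L_2(g_\theta)$ and $$\Vert u_t-\tilde u\Vert_{L_2(g_\theta)}\le e^{-\gamma_\theta t}\,C_\theta\,\Vert u_0-\tilde u\Vert_{L_2(g_\theta)}.$$ -/

import Mathlib

namespace LoadBalancing

open Filter Topology

/-- The set `𝒱` of tails of probability measures on `ℕ`: real sequences with `v 0 = 1`,
`v k ≥ v (k + 1)` and limit `0`. -/
def tails : Set (ℕ → ℝ) :=
  {v | v 0 = 1 ∧ (∀ k, v (k + 1) ≤ v k) ∧ Tendsto v atTop (𝓝 0)}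

/-- The geometric sequence `g_θ(k) = θ ^ k` (used for `k ≥ 1`). -/
def geom (θ : ℝ) (k : ℕ) : ℝ := θ ^ k

/-- Finiteness of `∑_{k ≥ 1} x(k)² / w(k)`; the index `k ≥ 1` is written `k + 1` with `k : ℕ`. -/
def SqSummable (w x : ℕ → ℝ) : Prop :=
  Summable fun k : ℕ => x (k + 1) ^ 2 * (w (k + 1))⁻¹

/-- The Hilbert space `L₂(w)`, as a set of sequences vanishing at `0`. -/
def L2 (w : ℕ → ℝ) : Set (ℕ → ℝ) :=
  {x | x 0 = 0 ∧ SqSummable w x}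

/-- The norm `‖x‖_{L₂(w)} = (∑_{k ≥ 1} x(k)² / w(k))^{1/2}`. -/
noncomputable def L2norm (w x : ℕ → ℝ) : ℝ :=
  Real.sqrt (∑' k : ℕ, x (k + 1) ^ 2 * (w (k + 1))⁻¹)

/-- The set `𝒱 ∩ L₂(w)`. Elements of `𝒱` equal `1` at index `0`, so membership in `L₂(w)` means here
finiteness of the weighted sum over `k ≥ 1`. -/
def tailsL2 (w : ℕ → ℝ) : Set (ℕ → ℝ) :=
  {v | v ∈ tails ∧ SqSummable w v}

/-- The vector field `F = F₊ - F₋`, with values in the sequences vanishing at `0`. -/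
def field (α β : ℝ) (L : ℕ) (v : ℕ → ℝ) : ℕ → ℝ
  | 0 => 0
  | k + 1 => α * (v k ^ L - v (k + 1) ^ L) - β * (v (k + 1) - v (k + 2))

/-- `u` restricted to `[0, ∞)` is a solution with values in `𝒱` of
`u̇_t(k) = α (u_t(k-1)^L - u_t(k)^L) - β (u_t(k) - u_t(k+1))`, `k ≥ 1`
(with the right derivative at `t = 0`). -/
structure IsSolution (α β : ℝ) (L : ℕ) (u : ℝ → ℕ → ℝ) : Prop where
  mem : ∀ t, 0 ≤ t → u t ∈ tails
  deriv : ∀ t, 0 ≤ t → ∀ k, 1 ≤ k →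
    HasDerivWithinAt (fun s => u s k) (field α β L (u t) k) (Set.Ici 0) t

/-- The stable point `ũ(k) = ρ^{L^{k-1} + ⋯ + L + 1}` (so `ũ(0) = 1`), where `ρ = α / β`. -/
noncomputable def stablePoint (α β : ℝ) (L : ℕ) (k : ℕ) : ℝ :=
  (α / β) ^ (∑ i ∈ Finset.range k, L ^ i)

end LoadBalancing

/-!
By Kato's inequality, and because the interaction terms telescope, the tail sums
`A (k) = ∑_{k ≤ j ≤ N} |u_t(j) - ũ(j)|` are, up to the flux through the truncation level `N`,
subsolutions of `∂ₜ A (k + 1) = α (1 + L ρ ^ k) (A (k) - A (k + 1)) + β (A (k + 2) - A (k + 1))`,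
the backward equation of a reversible birth-death chain. For every `s` with `ρ < s < 1` this
equation has a positive supersolution decaying like `s ^ k`, and the exponential rate found in this
way is the same for `s = √θ` as for `s = ρ / √θ`. The reversible measure times the ratio of these
two supersolutions is a weight comparable to `θ ^ (-k)` for which the quadratic energy of the tails
decays exponentially. A slowly varying majorant of the initial deviation is propagated on bounded
time intervals, and this makes the flux vanish as `N → ∞`. Hardy's inequality compares the energy
with the norm.
-/

namespace LoadBalancing

open Filter Finset Topology

section Laplacian

/-- The Laplacian on the half-line `ℕ` with conductance `a k` on the edge `{k, k + 1}`. The value at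
the site `k + 1` carries the index `k`, so that no boundary convention is needed at `0`. -/
def laplacian (a f : ℕ → ℝ) (k : ℕ) : ℝ :=
  a k * (f k - f (k + 1)) + a (k + 1) * (f (k + 2) - f (k + 1))

theorem sum_mul_laplacian_sub_mul_laplacian (a f g : ℕ → ℝ) (N : ℕ) :
    ∑ k ∈ range N, (g (k + 1) * laplacian a f k - f (k + 1) * laplacian a g k) =
      a 0 * (f 0 * g 1 - f 1 * g 0) - a N * (f N * g (N + 1) - f (N + 1) * g N) := by
  rw [← sum_range_sub' (fun k => a k * (f k * g (k + 1) - f (k + 1) * g k))]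
  refine sum_congr rfl fun k _ => ?_
  simp only [laplacian]
  ring

theorem two_mul_mul_sub_le {p q : ℝ} (hp : 0 < p) (hq : 0 < q) (x y : ℝ) :
    2 * x * (y - x) ≤ p * (y ^ 2 / q - x ^ 2 / p) + x ^ 2 / p * (q - p) := by
  rw [← sub_nonneg]
  have h : p * (y ^ 2 / q - x ^ 2 / p) + x ^ 2 / p * (q - p) - 2 * x * (y - x) =
      (p * y - q * x) ^ 2 / (p * q) := by
    field_simp
    ring
  rw [h]
  positivity

theorem two_mul_laplacian_le {a φ : ℕ → ℝ} (ha : ∀ k, 0 ≤ a k) (hφ : ∀ k, 0 < φ k)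
    (z : ℕ → ℝ) (k : ℕ) :
    2 * z (k + 1) * laplacian a z k ≤
      φ (k + 1) * laplacian a (fun i => z i ^ 2 / φ i) k +
        z (k + 1) ^ 2 / φ (k + 1) * laplacian a φ k := by
  have left := mul_le_mul_of_nonneg_left
    (two_mul_mul_sub_le (hφ (k + 1)) (hφ k) (z (k + 1)) (z k)) (ha k)
  have right := mul_le_mul_of_nonneg_left
    (two_mul_mul_sub_le (hφ (k + 1)) (hφ (k + 2)) (z (k + 1)) (z (k + 2))) (ha (k + 1))
  simp only [laplacian]
  linarith

/-- One supersolution turns `z ^ 2` into `z ^ 2 / φ`; the Green formula then moves the Laplacian to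
the other one. -/
theorem sum_div_mul_laplacian_le {a m φ χ z : ℕ → ℝ} {κ : ℝ} {N : ℕ}
    (ha : ∀ k, 0 ≤ a k) (ha0 : a 0 = 0) (hφ : ∀ k, 0 < φ k) (hχ : ∀ k, 0 < χ k)
    (hφκ : ∀ k, laplacian a φ k ≤ -κ * (m (k + 1) * φ (k + 1)))
    (hχκ : ∀ k, laplacian a χ k ≤ -κ * (m (k + 1) * χ (k + 1)))
    (hz : z (N + 1) = 0) :
    ∑ k ∈ range N, χ (k + 1) / φ (k + 1) * (2 * z (k + 1) * laplacian a z k) ≤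
      -(2 * κ) * ∑ k ∈ range N, m (k + 1) * (χ (k + 1) / φ (k + 1)) * z (k + 1) ^ 2 := by
  set ζ : ℕ → ℝ := fun k => z k ^ 2 / φ k with hζ
  have hζ0 : ∀ k, 0 ≤ ζ k := fun k => div_nonneg (sq_nonneg _) (hφ k).le
  have green := sum_mul_laplacian_sub_mul_laplacian a ζ χ N
  have boundary : 0 ≤ a N * (ζ N * χ (N + 1)) :=
    mul_nonneg (ha N) (mul_nonneg (hζ0 N) (hχ _).le)
  have hζN : ζ (N + 1) = 0 := by simp [hζ, hz]
  rw [ha0, hζN, sum_sub_distrib] at green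
  have pointwise : ∀ k, χ (k + 1) / φ (k + 1) * (2 * z (k + 1) * laplacian a z k) ≤
      χ (k + 1) * laplacian a ζ k - κ * (m (k + 1) * (χ (k + 1) / φ (k + 1)) * z (k + 1) ^ 2) := by
    intro k
    have hφk := hφ (k + 1)
    have h := (two_mul_laplacian_le ha hφ z k).trans
      (add_le_add_right (mul_le_mul_of_nonneg_left (hφκ k) (hζ0 (k + 1))) _)
    refine (mul_le_mul_of_nonneg_left h (div_pos (hχ (k + 1)) hφk).le).trans_eq ?_
    simp only [hζ]
    field_simp
    ring
  have dual : ∑ k ∈ range N, ζ (k + 1) * laplacian a χ k ≤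
      -κ * ∑ k ∈ range N, m (k + 1) * (χ (k + 1) / φ (k + 1)) * z (k + 1) ^ 2 := by
    rw [mul_sum]
    refine sum_le_sum fun k _ => (mul_le_mul_of_nonneg_left (hχκ k) (hζ0 _)).trans_eq ?_
    simp only [hζ]
    ring
  have total := sum_le_sum fun k (_ : k ∈ range N) => pointwise k
  rw [sum_sub_distrib, ← mul_sum] at total
  linarith

end Laplacian

section Potential

variable {ρ r s P : ℝ} {p : ℕ → ℝ}

/-- Conductances of the reversible birth-death chain on `{1, 2, …}` which jumps up at rate `1` and
down from `k + 1` at rate `ρ * p (k + 1) / p k`; they are also its reversible measure. No current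
flows through the edge `{0, 1}`. -/
noncomputable def conductance (ρ : ℝ) (p : ℕ → ℝ) : ℕ → ℝ
  | 0 => 0
  | k + 1 => (ρ ^ (k + 1) * p (k + 1))⁻¹

/-- The function tending to `0` at infinity with decrements `s ^ k * p k`; for `ρ < s < 1` it is a
positive supersolution for the chain with conductances `conductance ρ p`. -/
noncomputable def potential (s : ℝ) (p : ℕ → ℝ) (k : ℕ) : ℝ := ∑' j, s ^ (k + j) * p (k + j)

theorem conductance_nonneg (hρ : 0 ≤ ρ) (hp : ∀ k, 1 ≤ p k) (k : ℕ) : 0 ≤ conductance ρ p k := by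
  cases k with
  | zero => exact le_rfl
  | succ k => exact inv_nonneg.2 (mul_nonneg (pow_nonneg hρ _) (zero_le_one.trans (hp _)))

theorem summable_pow_mul (hs : 0 ≤ s) (hs1 : s < 1) (hp : ∀ k, 1 ≤ p k) (hP : ∀ k, p k ≤ P)
    (k : ℕ) : Summable fun j => s ^ (k + j) * p (k + j) := by
  refine Summable.of_nonneg_of_le
    (fun j => mul_nonneg (pow_nonneg hs _) (zero_le_one.trans (hp _)))
    (fun j => mul_le_mul_of_nonneg_left (hP _) (pow_nonneg hs _)) ?_
  simpa only [pow_add] using ((summable_geometric_of_lt_one hs hs1).mul_left (s ^ k)).mul_right P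

theorem potential_sub_succ (hs : 0 ≤ s) (hs1 : s < 1) (hp : ∀ k, 1 ≤ p k) (hP : ∀ k, p k ≤ P)
    (k : ℕ) : potential s p k - potential s p (k + 1) = s ^ k * p k := by
  rw [potential, (summable_pow_mul hs hs1 hp hP k).tsum_eq_zero_add, potential, sub_eq_iff_eq_add]
  simp only [add_zero, add_assoc, add_comm 1]

theorem potential_le (hs : 0 ≤ s) (hs1 : s < 1) (hp : ∀ k, 1 ≤ p k) (hP : ∀ k, p k ≤ P) (k : ℕ) :
    potential s p k ≤ s ^ k * (P / (1 - s)) := by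
  have hgeom : HasSum (fun j => s ^ (k + j) * P) (s ^ k * (P / (1 - s))) := by
    rw [div_eq_inv_mul, ← mul_assoc]
    simpa only [pow_add] using ((hasSum_geometric_of_lt_one hs hs1).mul_left (s ^ k)).mul_right P
  exact hasSum_le (fun j => mul_le_mul_of_nonneg_left (hP _) (pow_nonneg hs _))
    (summable_pow_mul hs hs1 hp hP k).hasSum hgeom

theorem le_potential (hs : 0 ≤ s) (hs1 : s < 1) (hp : ∀ k, 1 ≤ p k) (hP : ∀ k, p k ≤ P) (k : ℕ) :
    s ^ k * p k ≤ potential s p k :=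
  (summable_pow_mul hs hs1 hp hP k).le_tsum 0 fun _ _ =>
    mul_nonneg (pow_nonneg hs _) (zero_le_one.trans (hp _))

theorem potential_pos (hs : 0 < s) (hs1 : s < 1) (hp : ∀ k, 1 ≤ p k) (hP : ∀ k, p k ≤ P) (k : ℕ) :
    0 < potential s p k :=
  (mul_pos (pow_pos hs k) (zero_lt_one.trans_le (hp k))).trans_le (le_potential hs.le hs1 hp hP k)

theorem conductance_mul_le (hρ : 0 < ρ) (hs : 0 < s) (hp : ∀ k, 1 ≤ p k) (k : ℕ) :
    conductance ρ p k * (s ^ k * p k) ≤ (s / ρ) ^ k := by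
  cases k with
  | zero => simp [conductance]
  | succ k =>
    have hpk := zero_lt_one.trans_le (hp (k + 1))
    rw [conductance, div_pow]
    exact le_of_eq (by field_simp)

theorem laplacian_potential_le (hρ : 0 < ρ) (hρs : ρ < s) (hs1 : s < 1) (hp : ∀ k, 1 ≤ p k)
    (hP : ∀ k, p k ≤ P) (k : ℕ) :
    laplacian (conductance ρ p) (potential s p) k ≤
      -((1 - ρ / s) * (1 - s) / P) * (conductance ρ p (k + 1) * potential s p (k + 1)) := by
  have hs := hρ.trans hρs
  have h1s : 0 < 1 - s := sub_pos.2 hs1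
  have hP0 : 0 < P := zero_lt_one.trans_le ((hp 0).trans (hP 0))
  have hpk := zero_lt_one.trans_le (hp (k + 1))
  have hρs' : 0 < 1 - ρ / s := sub_pos.2 ((div_lt_one hs).2 hρs)
  have current : conductance ρ p (k + 1) * (s ^ (k + 1) * p (k + 1)) = (s / ρ) ^ (k + 1) := by
    rw [conductance, div_pow]
    field_simp
  have mass : conductance ρ p (k + 1) * potential s p (k + 1) ≤
      (s / ρ) ^ (k + 1) * (P / (1 - s)) := by
    rw [← current, mul_assoc]
    refine mul_le_mul_of_nonneg_left ?_ (conductance_nonneg hρ.le hp _)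
    refine (potential_le hs.le hs1 hp hP _).trans ?_
    exact mul_le_mul_of_nonneg_right (le_mul_of_one_le_right (by positivity) (hp _)) (by positivity)
  calc laplacian (conductance ρ p) (potential s p) k
      = conductance ρ p k * (s ^ k * p k) -
          conductance ρ p (k + 1) * (s ^ (k + 1) * p (k + 1)) := by
        rw [laplacian, ← potential_sub_succ hs.le hs1 hp hP k,
          ← potential_sub_succ hs.le hs1 hp hP (k + 1)]
        ring
    _ ≤ (s / ρ) ^ k - (s / ρ) ^ (k + 1) := by
        rw [current]
        exact sub_le_sub_right (conductance_mul_le hρ hs hp k) _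
    _ = -((1 - ρ / s) * (1 - s) / P) * ((s / ρ) ^ (k + 1) * (P / (1 - s))) := by
        rw [pow_succ]
        field_simp
        ring
    _ ≤ _ := mul_le_mul_of_nonpos_left mass
        (neg_nonpos.2 (div_nonneg (mul_nonneg hρs'.le h1s.le) hP0.le))

/-- The Lyapunov weight, comparable to `(r ^ k)⁻¹ ^ 2`: the reversible measure times the ratio of
two supersolutions, whose parameters `ρ / r` and `r` have the same spectral gap. -/
noncomputable def lyapunovWeight (ρ r : ℝ) (p : ℕ → ℝ) (k : ℕ) : ℝ :=
  conductance ρ p k * (potential (ρ / r) p k / potential r p k)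

theorem sum_potential_div_mul_laplacian_le (hρ : 0 < ρ) (hρr : ρ < r) (hr1 : r < 1)
    (hp : ∀ k, 1 ≤ p k) (hP : ∀ k, p k ≤ P) {N : ℕ} {z : ℕ → ℝ} (hz : z (N + 1) = 0) :
    ∑ k ∈ range N, potential (ρ / r) p (k + 1) / potential r p (k + 1) *
        (2 * z (k + 1) * laplacian (conductance ρ p) z k) ≤
      -(2 * ((1 - ρ / r) * (1 - r) / P)) *
        ∑ k ∈ range N, lyapunovWeight ρ r p (k + 1) * z (k + 1) ^ 2 := by
  have hr := hρ.trans hρr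
  have hq : 0 < ρ / r := div_pos hρ hr
  have hq1 : ρ / r < 1 := (div_lt_one hr).2 hρr
  refine sum_div_mul_laplacian_le (conductance_nonneg hρ.le hp) rfl (potential_pos hr hr1 hp hP)
    (potential_pos hq hq1 hp hP) (laplacian_potential_le hρ hρr hr1 hp hP) (fun k => ?_) hz
  convert laplacian_potential_le hρ ((lt_div_iff₀ hr).2 (mul_lt_of_lt_one_right hρ hr1)) hq1 hp hP k
    using 3
  rw [div_div_cancel₀ hρ.ne', mul_comm]

theorem lyapunovWeight_nonneg (hρ : 0 < ρ) (hρr : ρ < r) (hr1 : r < 1)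
    (hp : ∀ k, 1 ≤ p k) (hP : ∀ k, p k ≤ P) (k : ℕ) : 0 ≤ lyapunovWeight ρ r p k := by
  have hr := hρ.trans hρr
  exact mul_nonneg (conductance_nonneg hρ.le hp k) (div_pos
    (potential_pos (div_pos hρ hr) ((div_lt_one hr).2 hρr) hp hP k)
    (potential_pos hr hr1 hp hP k)).le

theorem lyapunovWeight_le (hρ : 0 < ρ) (hρr : ρ < r) (hr1 : r < 1) (hp : ∀ k, 1 ≤ p k)
    (hP : ∀ k, p k ≤ P) (k : ℕ) :
    lyapunovWeight ρ r p (k + 1) ≤ P / (1 - ρ / r) * ((r ^ (k + 1))⁻¹) ^ 2 := by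
  have hr := hρ.trans hρr
  have hpk := zero_lt_one.trans_le (hp (k + 1))
  have numerator := potential_le (div_pos hρ hr).le ((div_lt_one hr).2 hρr) hp hP (k + 1)
  have denominator : r ^ (k + 1) * p (k + 1) ≤ potential r p (k + 1) :=
    le_potential hr.le hr1 hp hP (k + 1)
  have hc : 0 < 1 - ρ / r := sub_pos.2 ((div_lt_one hr).2 hρr)
  have hP0 : 0 < P := hpk.trans_le (hP _)
  calc lyapunovWeight ρ r p (k + 1)
      ≤ (ρ ^ (k + 1) * p (k + 1))⁻¹ *
          ((ρ / r) ^ (k + 1) * (P / (1 - ρ / r)) / (r ^ (k + 1) * p (k + 1))) :=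
        mul_le_mul_of_nonneg_left
          (div_le_div₀ (by positivity) numerator (by positivity) denominator)
          (conductance_nonneg hρ.le hp _)
    _ = P / (1 - ρ / r) * ((r ^ (k + 1))⁻¹) ^ 2 / p (k + 1) ^ 2 := by
        rw [div_pow]
        field_simp
    _ ≤ _ := div_le_self (by positivity) (one_le_pow₀ (hp _))

theorem le_lyapunovWeight (hρ : 0 < ρ) (hρr : ρ < r) (hr1 : r < 1) (hp : ∀ k, 1 ≤ p k)
    (hP : ∀ k, p k ≤ P) (k : ℕ) :
    ((r ^ (k + 1))⁻¹) ^ 2 ≤ P / (1 - r) * lyapunovWeight ρ r p (k + 1) := by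
  have hr := hρ.trans hρr
  have hpk := zero_lt_one.trans_le (hp (k + 1))
  have h1r : 0 < 1 - r := sub_pos.2 hr1
  have hP0 : 0 < P := hpk.trans_le (hP _)
  have numerator := le_potential (div_pos hρ hr).le ((div_lt_one hr).2 hρr) hp hP (k + 1)
  have denominator := potential_le hr.le hr1 hp hP (k + 1)
  calc ((r ^ (k + 1))⁻¹) ^ 2
      = P / (1 - r) * ((ρ ^ (k + 1) * p (k + 1))⁻¹ *
          ((ρ / r) ^ (k + 1) * p (k + 1) / (r ^ (k + 1) * (P / (1 - r))))) := by
        rw [div_pow]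
        field_simp
    _ ≤ _ := mul_le_mul_of_nonneg_left (mul_le_mul_of_nonneg_left
        (div_le_div₀ (potential_pos (div_pos hρ hr) ((div_lt_one hr).2 hρr) hp hP _).le
          numerator (potential_pos hr hr1 hp hP _) denominator) (by positivity)) (by positivity)

end Potential

section RateProd

variable {ρ : ℝ}

/-- The partial products `∏ (1 + L ρ ^ i)`, bounded in `k`, which measure how far the dominating
rates `α * (1 + L ρ ^ k)` are from the constant rate `α`. -/
noncomputable def rateProd (ρ : ℝ) (L k : ℕ) : ℝ := ∏ i ∈ range k, (1 + L * ρ ^ i)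

theorem one_le_rateProd (hρ : 0 ≤ ρ) (L k : ℕ) : 1 ≤ rateProd ρ L k :=
  one_le_prod fun i _ => le_add_of_nonneg_right (by positivity)

theorem rateProd_le (hρ : 0 ≤ ρ) (hρ1 : ρ < 1) (L k : ℕ) :
    rateProd ρ L k ≤ Real.exp (L * (1 - ρ)⁻¹) := by
  refine (Real.prod_one_add_le_exp_sum _ fun i => by positivity).trans (Real.exp_le_exp.2 ?_)
  rw [← mul_sum, ← tsum_geometric_of_lt_one hρ hρ1]
  exact mul_le_mul_of_nonneg_left ((summable_geometric_of_lt_one hρ hρ1).sum_le_tsum _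
    fun i _ => pow_nonneg hρ i) L.cast_nonneg

theorem conductance_rateProd_succ (hρ : 0 < ρ) (L k : ℕ) :
    conductance ρ (rateProd ρ L) (k + 2) * (ρ * (1 + L * ρ ^ (k + 1))) =
      conductance ρ (rateProd ρ L) (k + 1) := by
  have hpk := zero_lt_one.trans_le (one_le_rateProd hρ.le L (k + 1))
  rw [conductance, conductance, rateProd, prod_range_succ, ← rateProd, pow_succ ρ (k + 1)]
  field_simp

end RateProd

section AbsTail

/-- The tail sums `∑_{j = k}^{N} |x j|`. Truncating at `N` makes them finite combinations of
differentiable functions along a solution. -/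
def absTail (N : ℕ) (x : ℕ → ℝ) (k : ℕ) : ℝ := ∑ j ∈ Ico k (N + 1), |x j|

theorem absTail_nonneg (N : ℕ) (x : ℕ → ℝ) (k : ℕ) : 0 ≤ absTail N x k :=
  sum_nonneg fun _ _ => abs_nonneg _

theorem absTail_succ_self (N : ℕ) (x : ℕ → ℝ) : absTail N x (N + 1) = 0 := by simp [absTail]

theorem absTail_eq_add {N k : ℕ} (hk : k ≤ N) (x : ℕ → ℝ) :
    absTail N x k = |x k| + absTail N x (k + 1) :=
  sum_eq_sum_Ico_succ_bot (Nat.lt_succ_of_le hk) _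

theorem abs_le_absTail {N k : ℕ} (hk : k ≤ N) (x : ℕ → ℝ) : |x k| ≤ absTail N x k :=
  (le_add_of_nonneg_right (absTail_nonneg N x _)).trans_eq (absTail_eq_add hk x).symm

/-- Hardy's inequality for the geometric kernel `r ^ j`. -/
theorem sum_sq_le_of_eq_add_mul_succ {r : ℝ} (hr : 0 ≤ r) (hr1 : r < 1) {y Y : ℕ → ℝ} {N : ℕ}
    (hY : ∀ k < N, Y k = y k + r * Y (k + 1)) (hYN : Y N = 0) :
    ∑ k ∈ range N, Y k ^ 2 ≤ ((1 - r) ^ 2)⁻¹ * ∑ k ∈ range N, y k ^ 2 := by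
  have h1r : 0 < 1 - r := sub_pos.2 hr1
  have step : ∀ k ∈ range N, Y k ^ 2 ≤ r * Y (k + 1) ^ 2 + (1 - r)⁻¹ * y k ^ 2 := by
    intro k hk
    have h : r * Y (k + 1) ^ 2 + (1 - r)⁻¹ * y k ^ 2 - (y k + r * Y (k + 1)) ^ 2 =
        r / (1 - r) * (y k - (1 - r) * Y (k + 1)) ^ 2 := by
      field_simp
      ring
    rw [hY k (mem_range.1 hk), ← sub_nonneg, h]
    positivity
  have shift : ∑ k ∈ range N, Y (k + 1) ^ 2 ≤ ∑ k ∈ range N, Y k ^ 2 := by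
    have h := (sum_range_succ' (fun k => Y k ^ 2) N).symm.trans (sum_range_succ _ N)
    rw [hYN] at h
    linarith [sq_nonneg (Y 0)]
  have total := sum_le_sum step
  rw [sum_add_distrib, ← mul_sum, ← mul_sum] at total
  have absorbed : (1 - r) * ∑ k ∈ range N, Y k ^ 2 ≤ (1 - r)⁻¹ * ∑ k ∈ range N, y k ^ 2 := by
    linarith [mul_le_mul_of_nonneg_left shift hr]
  rw [← le_div_iff₀' h1r] at absorbed
  exact absorbed.trans_eq (by field_simp)

theorem sum_sq_absTail_div_le {r : ℝ} (hr : 0 < r) (hr1 : r < 1) (N : ℕ) (x : ℕ → ℝ) :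
    ∑ k ∈ range N, (absTail N x (k + 1) / r ^ (k + 1)) ^ 2 ≤
      ((1 - r) ^ 2)⁻¹ * ∑ k ∈ range N, (x (k + 1) / r ^ (k + 1)) ^ 2 := by
  have h := sum_sq_le_of_eq_add_mul_succ hr.le hr1 (N := N)
    (y := fun k => |x (k + 1)| / r ^ (k + 1)) (Y := fun k => absTail N x (k + 1) / r ^ (k + 1))
    (fun k hk => by
      rw [absTail_eq_add hk, pow_succ r (k + 1)]
      field_simp)
    (by rw [absTail_succ_self, zero_div])
  simpa only [div_pow, sq_abs] using h

theorem absTail_le {r B : ℝ} (hr : 0 ≤ r) (hr1 : r < 1) {x : ℕ → ℝ} (hx : ∀ k, |x k| ≤ B * r ^ k)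
    (N k : ℕ) : absTail N x k ≤ B * (r ^ k / (1 - r)) := by
  have hB : 0 ≤ B := by simpa using (abs_nonneg _).trans (hx 0)
  refine (sum_le_sum fun j _ => hx j).trans ?_
  rw [← mul_sum]
  exact mul_le_mul_of_nonneg_left (geom_sum_Ico_le_of_lt_one hr hr1) hB

theorem sum_inv_pow_succ_le {r : ℝ} (hr : 0 < r) (hr1 : r < 1) (N : ℕ) :
    ∑ k ∈ range N, (r ^ (k + 1))⁻¹ ≤ (r ^ N)⁻¹ / (1 - r) := by
  have h1r : 0 < 1 - r := sub_pos.2 hr1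
  induction N with
  | zero => simpa using h1r.le
  | succ N ih =>
    rw [sum_range_succ]
    refine (add_le_add_left ih _).trans_eq ?_
    rw [pow_succ]
    field_simp
    ring

theorem sum_mul_absTail_le {r B K : ℝ} (hr : 0 < r) (hr1 : r < 1) {w x : ℕ → ℝ}
    (hw0 : ∀ k, 0 ≤ w k) (hw : ∀ k, w (k + 1) ≤ K * ((r ^ (k + 1))⁻¹) ^ 2)
    (hx : ∀ k, |x k| ≤ B * r ^ k) (N : ℕ) :
    ∑ k ∈ range N, w (k + 1) * absTail N x (k + 1) ≤ K * B / (1 - r) ^ 2 * (r ^ N)⁻¹ := by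
  have h1r : 0 < 1 - r := sub_pos.2 hr1
  have hB : 0 ≤ B := by simpa using (abs_nonneg _).trans (hx 0)
  have hK : 0 ≤ K := nonneg_of_mul_nonneg_left ((hw0 _).trans (hw 0)) (by positivity)
  calc ∑ k ∈ range N, w (k + 1) * absTail N x (k + 1)
      ≤ ∑ k ∈ range N, K * B / (1 - r) * (r ^ (k + 1))⁻¹ := by
        refine sum_le_sum fun k _ => ?_
        refine (mul_le_mul (hw k) (absTail_le hr.le hr1 hx N _) (absTail_nonneg _ _ _)
          (by positivity)).trans_eq ?_
        field_simp
    _ ≤ K * B / (1 - r) * ((r ^ N)⁻¹ / (1 - r)) := by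
        rw [← mul_sum]
        exact mul_le_mul_of_nonneg_left (sum_inv_pow_succ_le hr hr1 N) (by positivity)
    _ = K * B / (1 - r) ^ 2 * (r ^ N)⁻¹ := by field_simp

theorem abs_mul_sum_mul_absTail_le {r B K : ℝ} (hr : 0 < r) (hr1 : r < 1) {w x M : ℕ → ℝ}
    (hw0 : ∀ k, 0 ≤ w k) (hw : ∀ k, w (k + 1) ≤ K * ((r ^ (k + 1))⁻¹) ^ 2)
    (hx : ∀ k, |x k| ≤ M k * r ^ k) (hM : ∀ k, M k ≤ B) (N : ℕ) :
    |x (N + 1)| * ∑ k ∈ range N, w (k + 1) * absTail N x (k + 1) ≤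
      K * B / (1 - r) ^ 2 * r * M (N + 1) := by
  have hsum := sum_mul_absTail_le hr hr1 hw0 hw
    (fun k => (hx k).trans (mul_le_mul_of_nonneg_right (hM k) (pow_pos hr k).le)) N
  have hsum0 : 0 ≤ ∑ k ∈ range N, w (k + 1) * absTail N x (k + 1) :=
    sum_nonneg fun k _ => mul_nonneg (hw0 _) (absTail_nonneg _ _ _)
  calc |x (N + 1)| * ∑ k ∈ range N, w (k + 1) * absTail N x (k + 1)
      ≤ M (N + 1) * r ^ (N + 1) * (K * B / (1 - r) ^ 2 * (r ^ N)⁻¹) :=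
        mul_le_mul (hx _) hsum hsum0 ((abs_nonneg _).trans (hx _))
    _ = K * B / (1 - r) ^ 2 * r * M (N + 1) := by
        rw [pow_succ]
        field_simp

end AbsTail

section AbsDeriv

/-- The right derivative of `|f|` at a point where `f` has the value `x` and the right derivative
`v`. -/
noncomputable def absRightDeriv (x v : ℝ) : ℝ := if x = 0 then |v| else SignType.sign x * v

theorem hasDerivWithinAt_abs {f : ℝ → ℝ} {f' t : ℝ} (h : HasDerivWithinAt f f' (Set.Ici t) t) :
    HasDerivWithinAt (fun s => |f s|) (absRightDeriv (f t) f') (Set.Ici t) t := by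
  by_cases hf : f t = 0
  · rw [absRightDeriv, if_pos hf]
    rw [hasDerivWithinAt_iff_tendsto_slope] at h ⊢
    refine h.abs.congr' ?_
    filter_upwards [self_mem_nhdsWithin] with s hs
    have hts : 0 ≤ s - t := sub_nonneg.2 hs.1
    simp [slope_def_field, hf, abs_div, abs_of_nonneg hts]
  · rw [absRightDeriv, if_neg hf]
    exact (hasDerivAt_abs hf).comp_hasDerivWithinAt t h

/-- Kato's inequality. -/
theorem absRightDeriv_le (x b e : ℝ) : absRightDeriv x (e - b * x) ≤ |e| - b * |x| := by
  rcases eq_or_ne x 0 with rfl | hx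
  · simp [absRightDeriv]
  · have hsign : (SignType.sign x : ℝ) * e ≤ |e| := by
      rcases hx.lt_or_gt with h | h
      · simpa [sign_neg h] using neg_le_abs e
      · simpa [sign_pos h] using le_abs_self e
    rw [absRightDeriv, if_neg hx, mul_sub, mul_left_comm, sign_mul_self]
    exact sub_le_sub_right hsign _

end AbsDeriv

section Field

variable {α β : ℝ} {L : ℕ} {v : ℕ → ℝ}

theorem stablePoint_zero (α β : ℝ) (L : ℕ) : stablePoint α β L 0 = 1 := by simp [stablePoint]

theorem stablePoint_succ (α β : ℝ) (L k : ℕ) :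
    stablePoint α β L (k + 1) = α / β * stablePoint α β L k ^ L := by
  rw [stablePoint, stablePoint, geom_sum_succ, pow_succ, mul_comm, ← pow_mul, mul_comm L]

theorem stablePoint_nonneg (hα : 0 ≤ α) (hβ : 0 ≤ β) (L k : ℕ) : 0 ≤ stablePoint α β L k :=
  pow_nonneg (div_nonneg hα hβ) _

theorem stablePoint_le_pow (hα : 0 ≤ α) (hβ : 0 ≤ β) (hρ : α / β ≤ 1) (hL : 1 ≤ L) (k : ℕ) :
    stablePoint α β L k ≤ (α / β) ^ k := by
  refine pow_le_pow_of_le_one (div_nonneg hα hβ) hρ ?_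
  simpa using sum_le_sum fun i (_ : i ∈ range k) => Nat.one_le_pow i L hL

theorem tails_nonneg (hv : v ∈ tails) (k : ℕ) : 0 ≤ v k :=
  (antitone_nat_of_succ_le hv.2.1).le_of_tendsto hv.2.2 k

theorem tails_le_one (hv : v ∈ tails) (k : ℕ) : v k ≤ 1 :=
  hv.1 ▸ antitone_nat_of_succ_le hv.2.1 (Nat.zero_le k)

theorem exists_pow_sub_pow_eq_mul {x y : ℝ} (hx : 0 ≤ x) (hx1 : x ≤ 1) (hy : 0 ≤ y) (hy1 : y ≤ 1)
    (L : ℕ) : ∃ c, 0 ≤ c ∧ c ≤ 1 + L * y ∧ x ^ L - y ^ L = c * (x - y) := by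
  refine ⟨∑ i ∈ range L, x ^ i * y ^ (L - 1 - i), sum_nonneg fun i _ => by positivity, ?_,
    ((Commute.all x y).geom_sum₂_mul L).symm⟩
  cases L with
  | zero => simp
  | succ n =>
    have lower : ∀ i ∈ range n, x ^ i * y ^ (n - i) ≤ y := fun i hi =>
      (mul_le_of_le_one_left (by positivity) (pow_le_one₀ hx hx1)).trans
        (pow_le_of_le_one hy hy1 (Nat.sub_ne_zero_of_lt (mem_range.1 hi)))
    have top : x ^ n ≤ 1 := pow_le_one₀ hx hx1
    have total := sum_le_card_nsmul _ _ _ lower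
    rw [card_range, nsmul_eq_mul] at total
    rw [sum_range_succ, add_tsub_cancel_right, Nat.sub_self, pow_zero, mul_one, Nat.cast_succ]
    linarith

theorem field_succ_eq (hα : 0 ≤ α) (hβ : 0 < β) (hρ : α / β ≤ 1) (hL : 1 ≤ L) (hv : v ∈ tails) :
    ∃ c : ℕ → ℝ, (∀ k, 0 ≤ c k ∧ c k ≤ 1 + L * (α / β) ^ k) ∧
      ∀ k, field α β L v (k + 1) =
        α * c k * (v - stablePoint α β L) k + β * (v - stablePoint α β L) (k + 2) -
          (α * c (k + 1) + β) * (v - stablePoint α β L) (k + 1) := by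
  have hle := stablePoint_le_pow hα hβ.le hρ hL
  choose c hc0 hc hpow using fun k => exists_pow_sub_pow_eq_mul (tails_nonneg hv k)
    (tails_le_one hv k) (stablePoint_nonneg hα hβ.le L k)
    ((hle k).trans (pow_le_one₀ (div_nonneg hα hβ.le) hρ)) L
  refine ⟨c, fun k => ⟨hc0 k, (hc k).trans (by gcongr; exact hle k)⟩, fun k => ?_⟩
  have balance : ∀ j, β * stablePoint α β L (j + 1) = α * stablePoint α β L j ^ L := fun j => by
    rw [stablePoint_succ]
    field_simp
  simp only [Pi.sub_apply, field]
  linear_combination α * hpow k - α * hpow (k + 1) - balance k + balance (k + 1)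

/-- The right derivative of `absTail N x k` when `x` moves with velocity `y`. -/
noncomputable def absTailRightDeriv (N : ℕ) (x y : ℕ → ℝ) (k : ℕ) : ℝ :=
  ∑ j ∈ Ico k (N + 1), absRightDeriv (x j) (y j)

/-- The interaction terms telescope, so only the two ends of the tail contribute. -/
theorem absTailRightDeriv_field_le (hα : 0 ≤ α) (hβ : 0 < β) (hρ : α / β ≤ 1) (hL : 1 ≤ L)
    (hv : v ∈ tails) {N k : ℕ} (hk : k ≤ N) :
    absTailRightDeriv N (v - stablePoint α β L) (field α β L v) (k + 1) ≤
      α * (1 + L * (α / β) ^ k) * |(v - stablePoint α β L) k| -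
        β * |(v - stablePoint α β L) (k + 1)| + β * |(v - stablePoint α β L) (N + 1)| := by
  obtain ⟨c, hc, hfield⟩ := field_succ_eq hα hβ hρ hL hv
  set x := v - stablePoint α β L
  set current : ℕ → ℝ := fun j => α * c j * |x j| - β * |x (j + 1)| with hcurrent
  have hαc : ∀ j, 0 ≤ α * c j := fun j => mul_nonneg hα (hc j).1
  have pointwise : ∀ j, absRightDeriv (x (j + 1)) (field α β L v (j + 1)) ≤
      -(current (j + 1) - current j) := by
    intro j
    have incoming : |α * c j * x j + β * x (j + 2)| ≤ α * c j * |x j| + β * |x (j + 2)| := by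
      refine (abs_add_le _ _).trans_eq ?_
      rw [abs_mul (α * c j), abs_mul β, abs_of_nonneg (hαc j), abs_of_pos hβ]
    rw [hfield]
    refine (absRightDeriv_le _ _ _).trans ?_
    simp only [hcurrent]
    linarith
  have inflow : α * c k * |x k| ≤ α * (1 + L * (α / β) ^ k) * |x k| := by
    gcongr
    exact (hc k).2
  have outflow : 0 ≤ α * c N * |x N| := mul_nonneg (hαc N) (abs_nonneg _)
  have total := sum_le_sum fun j (_ : j ∈ Ico k N) => pointwise j
  rw [sum_neg_distrib, sum_Ico_sub current hk] at total
  rw [absTailRightDeriv, ← sum_Ico_add' (fun j => absRightDeriv (x j) (field α β L v j))]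
  refine total.trans ?_
  simp only [hcurrent]
  linarith

theorem conductance_mul_absTailRightDeriv_le (hα : 0 < α) (hβ : 0 < β) (hρ : α / β ≤ 1)
    (hL : 1 ≤ L) (hv : v ∈ tails) {N k : ℕ} (hk : k < N) :
    conductance (α / β) (rateProd (α / β) L) (k + 1) *
        absTailRightDeriv N (v - stablePoint α β L) (field α β L v) (k + 1) ≤
      β * laplacian (conductance (α / β) (rateProd (α / β) L))
          (absTail N (v - stablePoint α β L)) k +
        conductance (α / β) (rateProd (α / β) L) (k + 1) *
          (β * |(v - stablePoint α β L) (N + 1)|) := by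
  have hbound := absTailRightDeriv_field_le hα.le hβ hρ hL hv hk.le
  have hx0 : (v - stablePoint α β L) 0 = 0 := by
    rw [Pi.sub_apply, hv.1, stablePoint_zero, sub_self]
  have hρ0 : 0 < α / β := div_pos hα hβ
  set x := v - stablePoint α β L
  set a := conductance (α / β) (rateProd (α / β) L)
  have detailedBalance : a (k + 1) * (α * (1 + L * (α / β) ^ k) * |x k|) = β * (a k * |x k|) := by
    cases k with
    | zero => simp [hx0]
    | succ k =>
      simp only [a, ← conductance_rateProd_succ hρ0 L k]
      field_simp
  have hlaplacian : laplacian a (absTail N x) k = a k * |x k| - a (k + 1) * |x (k + 1)| := by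
    rw [laplacian, absTail_eq_add hk.le, absTail_eq_add hk]
    ring
  rw [hlaplacian]
  have ha : 0 ≤ a (k + 1) := conductance_nonneg hρ0.le (one_le_rateProd hρ0.le L) _
  linarith [mul_le_mul_of_nonneg_left hbound ha]

/-- The Lyapunov weight for the rates `α * (1 + L ρ ^ k)`, which dominate the load-balancing rates
near the stable point. -/
noncomputable def energyWeight (α β r : ℝ) (L : ℕ) : ℕ → ℝ :=
  lyapunovWeight (α / β) r (rateProd (α / β) L)

/-- The truncated quadratic energy of the tails of `|x|`, with weight `w`. -/
def energy (w : ℕ → ℝ) (N : ℕ) (x : ℕ → ℝ) : ℝ :=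
  ∑ k ∈ range N, w (k + 1) * absTail N x (k + 1) ^ 2

/-- The right derivative of `energy w N x` when `x` moves with velocity `y`. -/
noncomputable def energyRightDeriv (w : ℕ → ℝ) (N : ℕ) (x y : ℕ → ℝ) : ℝ :=
  ∑ k ∈ range N, w (k + 1) * (2 * absTail N x (k + 1) * absTailRightDeriv N x y (k + 1))

theorem energyRightDeriv_field_le {r P : ℝ} (hα : 0 < α) (hβ : 0 < β) (hρr : α / β < r)
    (hr1 : r < 1) (hP : ∀ k, rateProd (α / β) L k ≤ P) (hL : 1 ≤ L) (hv : v ∈ tails) (N : ℕ) :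
    energyRightDeriv (energyWeight α β r L) N (v - stablePoint α β L) (field α β L v) ≤
      -(2 * β * ((1 - α / β / r) * (1 - r) / P)) *
          energy (energyWeight α β r L) N (v - stablePoint α β L) +
        2 * β * |(v - stablePoint α β L) (N + 1)| * ∑ k ∈ range N,
          energyWeight α β r L (k + 1) * absTail N (v - stablePoint α β L) (k + 1) := by
  have hρ0 : 0 < α / β := div_pos hα hβ
  have hr := hρ0.trans hρr
  have hp := one_le_rateProd hρ0.le L
  have hstep := fun k (hk : k ∈ range N) => conductance_mul_absTailRightDeriv_le hα hβ
    (hρr.trans hr1).le hL hv (mem_range.1 hk)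
  set x := v - stablePoint α β L
  set p := rateProd (α / β) L with hpdef
  have gap := sum_potential_div_mul_laplacian_le hρ0 hρr hr1 hp hP (absTail_succ_self N x)
  have termwise := sum_le_sum fun k hk => mul_le_mul_of_nonneg_left (hstep k hk)
    (mul_nonneg (div_pos (potential_pos (div_pos hρ0 hr) ((div_lt_one hr).2 hρr) hp hP (k + 1))
      (potential_pos hr hr1 hp hP (k + 1))).le
      (mul_nonneg zero_le_two (absTail_nonneg N x (k + 1))))
  simp only [energyRightDeriv, energy, energyWeight, ← hpdef]
  calc _ ≤ _ := (sum_congr rfl fun k _ => by rw [lyapunovWeight]; ring).trans_le termwise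
    _ = β * ∑ k ∈ range N, potential (α / β / r) p (k + 1) / potential r p (k + 1) *
          (2 * absTail N x (k + 1) * laplacian (conductance (α / β) p) (absTail N x) k) +
        2 * β * |x (N + 1)| *
          ∑ k ∈ range N, lyapunovWeight (α / β) r p (k + 1) * absTail N x (k + 1) := by
        rw [mul_sum, mul_sum, ← sum_add_distrib]
        refine sum_congr rfl fun k _ => ?_
        rw [lyapunovWeight]
        ring
    _ ≤ _ := by linarith [mul_le_mul_of_nonneg_left gap hβ.le]

end Field

section Derivative

variable {t : ℝ} {x : ℝ → ℕ → ℝ} {y : ℕ → ℝ}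

theorem hasDerivWithinAt_absTail
    (hx : ∀ k, HasDerivWithinAt (fun s => x s k) (y k) (Set.Ici t) t) (N k : ℕ) :
    HasDerivWithinAt (fun s => absTail N (x s) k) (absTailRightDeriv N (x t) y k) (Set.Ici t) t :=
  HasDerivWithinAt.fun_sum fun j _ => hasDerivWithinAt_abs (hx j)

theorem hasDerivWithinAt_energy
    (hx : ∀ k, HasDerivWithinAt (fun s => x s k) (y k) (Set.Ici t) t) (w : ℕ → ℝ) (N : ℕ) :
    HasDerivWithinAt (fun s => energy w N (x s)) (energyRightDeriv w N (x t) y) (Set.Ici t) t :=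
  HasDerivWithinAt.fun_sum fun k _ =>
    (by simpa using (hasDerivWithinAt_absTail hx N (k + 1)).fun_pow 2 :
      HasDerivWithinAt (fun s => absTail N (x s) (k + 1) ^ 2) _ _ _).const_mul (w (k + 1))

theorem continuousOn_energy {S : Set ℝ} (hx : ∀ k, ContinuousOn (fun s => x s k) S)
    (w : ℕ → ℝ) (N : ℕ) : ContinuousOn (fun s => energy w N (x s)) S :=
  continuousOn_finsetSum _ fun _ _ =>
    ((continuousOn_finsetSum _ fun j _ => (hx j).abs).pow 2).const_mul _

end Derivative

section Majorant

/-- The convolution of `f` with `2⁻¹ ^ j`, with `f` extended by `f 0` to the left, varies slowly. -/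
theorem exists_tendsto_majorant {f : ℕ → ℝ} (hf0 : ∀ k, 0 ≤ f k) (hf : Tendsto f atTop (𝓝 0)) :
    ∃ h : ℕ → ℝ, Tendsto h atTop (𝓝 0) ∧ (∀ k, f k ≤ h k) ∧ ∀ k, h k ≤ 2 * h (k + 1) := by
  obtain ⟨B, hB⟩ := hf.bddAbove_range
  have hfB : ∀ k, f k ≤ B := fun k => hB ⟨k, rfl⟩
  have hgeom : Summable fun j : ℕ => (2⁻¹ : ℝ) ^ j * B :=
    (summable_geometric_of_lt_one (by norm_num) (by norm_num)).mul_right B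
  have hsummable : ∀ k, Summable fun j => (2⁻¹ : ℝ) ^ j * f (k - j) := fun k =>
    hgeom.of_nonneg_of_le (fun j => mul_nonneg (by positivity) (hf0 _))
      fun j => mul_le_mul_of_nonneg_left (hfB _) (by positivity)
  have hterm : ∀ k j, 0 ≤ (2⁻¹ : ℝ) ^ j * f (k - j) := fun k j => mul_nonneg (by positivity) (hf0 _)
  refine ⟨fun k => ∑' j, (2⁻¹ : ℝ) ^ j * f (k - j), ?_, fun k => ?_, fun k => ?_⟩
  · rw [show 𝓝 (0 : ℝ) = 𝓝 (∑' _ : ℕ, 0) by rw [tsum_zero]]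
    refine tendsto_tsum_of_dominated_convergence hgeom (fun j => ?_)
      (Eventually.of_forall fun k j => ?_)
    · simpa using (hf.comp (tendsto_sub_atTop_nat j)).const_mul ((2⁻¹ : ℝ) ^ j)
    · rw [Real.norm_of_nonneg (hterm k j)]
      exact mul_le_mul_of_nonneg_left (hfB _) (by positivity)
  · simpa using (hsummable k).le_tsum 0 fun j _ => hterm k j
  · beta_reduce
    rw [(hsummable (k + 1)).tsum_eq_zero_add]
    simp only [pow_zero, one_mul, tsub_zero, pow_succ', mul_assoc, Nat.reduceSubDiff, tsum_mul_left]
    linarith [hf0 (k + 1)]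

theorem exists_tendsto_majorant_mul_pow {r : ℝ} (hr : 0 < r) {f : ℕ → ℝ} (hf0 : ∀ k, 0 ≤ f k)
    (hf : Tendsto (fun k => f k / r ^ k) atTop (𝓝 0)) :
    ∃ h : ℕ → ℝ, Tendsto h atTop (𝓝 0) ∧ (∀ k, f k ≤ h k * r ^ k) ∧
      ∀ k, h k * r ^ k ≤ 2 / r * (h (k + 1) * r ^ (k + 1)) := by
  obtain ⟨h, hlim, hle, hslow⟩ :=
    exists_tendsto_majorant (fun k => div_nonneg (hf0 k) (pow_pos hr k).le) hf
  refine ⟨h, hlim, fun k => (div_le_iff₀ (pow_pos hr k)).1 (hle k), fun k => ?_⟩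
  refine (mul_le_mul_of_nonneg_right (hslow k) (pow_pos hr k).le).trans_eq ?_
  rw [pow_succ]
  field_simp

end Majorant

section Solution

variable {α β r P : ℝ} {L : ℕ} {u : ℝ → ℕ → ℝ}

theorem IsSolution.hasDerivWithinAt (hu : IsSolution α β L u) {t : ℝ} (ht : 0 ≤ t) (k : ℕ) :
    HasDerivWithinAt (fun s => u s k) (field α β L (u t) k) (Set.Ici t) t := by
  cases k with
  | zero =>
    refine (hasDerivWithinAt_const t (Set.Ici t) (1 : ℝ)).congr (fun s hs => ?_) (hu.mem t ht).1
    exact (hu.mem s (ht.trans hs)).1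
  | succ k => exact (hu.deriv t ht (k + 1) k.succ_pos).mono (Set.Ici_subset_Ici.2 ht)

theorem IsSolution.continuousOn (hu : IsSolution α β L u) (k : ℕ) :
    ContinuousOn (fun t => u t k) (Set.Ici 0) := by
  cases k with
  | zero => exact (continuousOn_const (c := (1 : ℝ))).congr fun t ht => (hu.mem t ht).1
  | succ k => exact fun t ht => (hu.deriv t ht (k + 1) k.succ_pos).continuousWithinAt

theorem IsSolution.le_exp_mul (hu : IsSolution α β L u) (hα : 0 ≤ α) (hβ : 0 ≤ β) (hL : 1 ≤ L)
    {l : ℝ} (hl : 0 ≤ l) {H : ℕ → ℝ} (h0 : ∀ k, u 0 k ≤ H k)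
    (hH : ∀ k, α * H k ≤ l * H (k + 1)) {t : ℝ} (ht : 0 ≤ t) (k : ℕ) :
    u t k ≤ Real.exp (l * t) * H k := by
  induction k generalizing t with
  | zero =>
    have hH0 : 1 ≤ H 0 := (hu.mem 0 le_rfl).1 ▸ h0 0
    rw [(hu.mem t ht).1]
    exact one_le_mul_of_one_le_of_one_le (Real.one_le_exp (mul_nonneg hl ht)) hH0
  | succ k ih =>
    have hexp : ∀ s, HasDerivAt (fun s => Real.exp (l * s) * H (k + 1))
        (Real.exp (l * s) * l * H (k + 1)) s := fun s => by
      simpa using (((hasDerivAt_id s).const_mul l).exp).mul_const (H (k + 1))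
    have hdrift : ∀ s ∈ Set.Ico 0 t,
        field α β L (u s) (k + 1) ≤ Real.exp (l * s) * l * H (k + 1) := by
      intro s hs
      have hv := hu.mem s hs.1
      have hpow : u s k ^ L ≤ u s k :=
        pow_le_of_le_one (tails_nonneg hv k) (tails_le_one hv k) (Nat.one_le_iff_ne_zero.1 hL)
      have hloss : 0 ≤ α * u s (k + 1) ^ L + β * (u s (k + 1) - u s (k + 2)) :=
        add_nonneg (mul_nonneg hα (pow_nonneg (tails_nonneg hv _) _))
          (mul_nonneg hβ (sub_nonneg.2 (hv.2.1 _)))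
      calc field α β L (u s) (k + 1) ≤ α * u s k ^ L := by
            rw [field]
            linarith
        _ ≤ α * (Real.exp (l * s) * H k) := mul_le_mul_of_nonneg_left (hpow.trans (ih hs.1)) hα
        _ = Real.exp (l * s) * (α * H k) := by ring
        _ ≤ Real.exp (l * s) * (l * H (k + 1)) :=
            mul_le_mul_of_nonneg_left (hH k) (Real.exp_pos _).le
        _ = Real.exp (l * s) * l * H (k + 1) := by ring
    exact image_le_of_deriv_right_le_deriv_boundary
      ((hu.continuousOn (k + 1)).mono Set.Icc_subset_Ici_self)
      (fun s hs => hu.hasDerivWithinAt hs.1 (k + 1)) (by simpa using h0 (k + 1))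
      (fun s _ => (hexp s).continuousAt.continuousWithinAt)
      (fun s _ => (hexp s).hasDerivWithinAt) hdrift (Set.right_mem_Icc.2 ht)

theorem tendsto_zero_of_summable_sq {f : ℕ → ℝ} (hf : Summable fun k => f (k + 1) ^ 2) :
    Tendsto f atTop (𝓝 0) := by
  have h := ((tendsto_add_atTop_iff_nat (f := fun k => f k ^ 2) 1).1 hf.tendsto_atTop_zero).sqrt
  rw [Real.sqrt_zero] at h
  exact (tendsto_zero_iff_abs_tendsto_zero _).2 (h.congr fun k => Real.sqrt_sq_eq_abs _)

theorem summable_sq_stablePoint_div_pow (hα : 0 < α) (hβ : 0 < β) (hρr : α / β < r)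
    (hr1 : r < 1) (hL : 1 ≤ L) :
    Summable fun k => (stablePoint α β L (k + 1) / r ^ (k + 1)) ^ 2 := by
  have hr : 0 < r := (div_pos hα hβ).trans hρr
  have hq : 0 ≤ α / β / r := by positivity
  have hq1 : α / β / r < 1 := (div_lt_one hr).2 hρr
  refine ((summable_nat_add_iff 1).2 (summable_geometric_of_lt_one (sq_nonneg _)
    (pow_lt_one₀ hq hq1 two_ne_zero))).of_nonneg_of_le (fun k => sq_nonneg _) fun k => ?_
  rw [← pow_mul, mul_comm, pow_mul, div_pow (α / β)]
  have hpow := stablePoint_le_pow hα.le hβ.le (hρr.trans hr1).le hL (k + 1)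
  have hnonneg := stablePoint_nonneg hα.le hβ.le L (k + 1)
  gcongr

theorem summable_sq_sub_stablePoint_div_pow (hα : 0 < α) (hβ : 0 < β) (hρr : α / β < r)
    (hr1 : r < 1) (hL : 1 ≤ L) {v : ℕ → ℝ}
    (hv : Summable fun k => (v (k + 1) / r ^ (k + 1)) ^ 2) :
    Summable fun k => ((v - stablePoint α β L) (k + 1) / r ^ (k + 1)) ^ 2 := by
  refine ((hv.add (summable_sq_stablePoint_div_pow hα hβ hρr hr1 hL)).mul_left 2).of_nonneg_of_le
    (fun _ => sq_nonneg _) fun k => ?_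
  rw [Pi.sub_apply, sub_div, sub_eq_add_neg, ← neg_sq (stablePoint α β L (k + 1) / _)]
  exact add_sq_le

theorem IsSolution.exists_deviation_bound (hu : IsSolution α β L u) (hα : 0 < α) (hβ : 0 < β)
    (hρr : α / β < r) (hr1 : r < 1) (hL : 1 ≤ L)
    (h0 : Summable fun k => (u 0 (k + 1) / r ^ (k + 1)) ^ 2) (T : ℝ) :
    ∃ M : ℕ → ℝ, Tendsto M atTop (𝓝 0) ∧
      ∀ t ∈ Set.Icc 0 T, ∀ k, |(u t - stablePoint α β L) k| ≤ M k * r ^ k := by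
  have hr : 0 < r := (div_pos hα hβ).trans hρr
  have hu0 := tails_nonneg (hu.mem 0 le_rfl)
  have hstable := stablePoint_nonneg hα.le hβ.le L
  have hdecay : Tendsto (fun k => (u 0 k + stablePoint α β L k) / r ^ k) atTop (𝓝 0) := by
    simpa only [add_zero, ← add_div] using
      (tendsto_zero_of_summable_sq (f := fun k => u 0 k / r ^ k) h0).add
        (tendsto_zero_of_summable_sq (f := fun k => stablePoint α β L k / r ^ k)
          (summable_sq_stablePoint_div_pow hα hβ hρr hr1 hL))
  obtain ⟨h, hlim, hle, hslow⟩ :=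
    exists_tendsto_majorant_mul_pow hr (fun k => add_nonneg (hu0 k) (hstable k)) hdecay
  have hrate : 0 ≤ α * (2 / r) := by positivity
  have hlim' : Tendsto (fun k => Real.exp (α * (2 / r) * T) * h k) atTop (𝓝 0) := by
    simpa only [mul_zero] using hlim.const_mul (Real.exp (α * (2 / r) * T))
  refine ⟨fun k => Real.exp (α * (2 / r) * T) * h k, hlim', fun t ht k => ?_⟩
  have hk : 0 ≤ h k * r ^ k := (add_nonneg (hu0 k) (hstable k)).trans (hle k)
  have hu_le : u t k ≤ Real.exp (α * (2 / r) * T) * h k * r ^ k := by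
    rw [mul_assoc (Real.exp _)]
    refine (hu.le_exp_mul hα.le hβ.le hL hrate
      (fun j => (le_add_of_nonneg_right (hstable j)).trans (hle j)) (fun j => ?_) ht.1 k).trans ?_
    · exact (mul_le_mul_of_nonneg_left (hslow j) hα.le).trans_eq (mul_assoc _ _ _).symm
    · exact mul_le_mul_of_nonneg_right
        (Real.exp_le_exp.2 (mul_le_mul_of_nonneg_left ht.2 hrate)) hk
  have hstable_le : stablePoint α β L k ≤ Real.exp (α * (2 / r) * T) * h k * r ^ k := by
    rw [mul_assoc (Real.exp _)]
    exact ((le_add_of_nonneg_left (hu0 k)).trans (hle k)).trans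
      (le_mul_of_one_le_left hk (Real.one_le_exp (mul_nonneg hrate (ht.1.trans ht.2))))
  exact abs_sub_le_of_nonneg_of_le (tails_nonneg (hu.mem t ht.1) k) hu_le (hstable k) hstable_le

theorem sum_sq_div_pow_le_energy (hρ : 0 < α / β) (hρr : α / β < r) (hr1 : r < 1)
    (hP : ∀ k, rateProd (α / β) L k ≤ P) (N : ℕ) (x : ℕ → ℝ) :
    ∑ k ∈ range N, (x (k + 1) / r ^ (k + 1)) ^ 2 ≤
      P / (1 - r) * energy (energyWeight α β r L) N x := by
  rw [energy, mul_sum]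
  refine sum_le_sum fun k hk => ?_
  have hweight := le_lyapunovWeight hρ hρr hr1 (one_le_rateProd hρ.le L) hP k
  have htail : x (k + 1) ^ 2 ≤ absTail N x (k + 1) ^ 2 :=
    sq_le_sq.2 ((abs_le_absTail (mem_range.1 hk) x).trans (le_abs_self _))
  rw [div_eq_mul_inv, mul_pow, mul_comm, ← mul_assoc]
  exact mul_le_mul hweight htail (sq_nonneg _) ((sq_nonneg _).trans hweight)

theorem energy_le_sum_sq_div_pow (hρ : 0 < α / β) (hρr : α / β < r) (hr1 : r < 1)
    (hP : ∀ k, rateProd (α / β) L k ≤ P) (N : ℕ) (x : ℕ → ℝ) :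
    energy (energyWeight α β r L) N x ≤
      P / (1 - α / β / r) * ((1 - r) ^ 2)⁻¹ * ∑ k ∈ range N, (x (k + 1) / r ^ (k + 1)) ^ 2 := by
  have hr := hρ.trans hρr
  have hc : 0 < 1 - α / β / r := sub_pos.2 ((div_lt_one hr).2 hρr)
  have hP0 : 0 < P := zero_lt_one.trans_le ((one_le_rateProd hρ.le L 0).trans (hP 0))
  calc energy (energyWeight α β r L) N x
      ≤ ∑ k ∈ range N, P / (1 - α / β / r) * (absTail N x (k + 1) / r ^ (k + 1)) ^ 2 := by
        refine sum_le_sum fun k _ => (mul_le_mul_of_nonneg_right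
          (lyapunovWeight_le hρ hρr hr1 (one_le_rateProd hρ.le L) hP k) (sq_nonneg _)).trans_eq ?_
        ring
    _ ≤ _ := by
        rw [← mul_sum, mul_assoc]
        exact mul_le_mul_of_nonneg_left (sum_sq_absTail_div_le hr hr1 N x) (by positivity)

/-- The mass escaping through the truncation level `N` enters only as a Grönwall error `ε N`. -/
theorem IsSolution.exists_energy_le_gronwallBound (hu : IsSolution α β L u) (hα : 0 < α)
    (hβ : 0 < β) (hρr : α / β < r) (hr1 : r < 1) (hP : ∀ k, rateProd (α / β) L k ≤ P)
    (hL : 1 ≤ L) (h0 : Summable fun k => (u 0 (k + 1) / r ^ (k + 1)) ^ 2) {T : ℝ} (hT : 0 ≤ T) :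
    ∃ ε : ℕ → ℝ, Tendsto ε atTop (𝓝 0) ∧ ∀ N δ,
      energy (energyWeight α β r L) N (u 0 - stablePoint α β L) ≤ δ →
      energy (energyWeight α β r L) N (u T - stablePoint α β L) ≤
        gronwallBound δ (-(2 * β * ((1 - α / β / r) * (1 - r) / P))) (ε N) T := by
  obtain ⟨M, hM, hdev⟩ := hu.exists_deviation_bound hα hβ hρr hr1 hL h0 T
  obtain ⟨B, hB⟩ := hM.bddAbove_range
  have hρ0 : 0 < α / β := div_pos hα hβ
  have hr := hρ0.trans hρr
  have hp := one_le_rateProd hρ0.le L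
  set K := P / (1 - α / β / r) * B / (1 - r) ^ 2 * r
  have hε : Tendsto (fun N => 2 * β * (K * M (N + 1))) atTop (𝓝 0) := by
    simpa only [mul_zero, Function.comp_def] using
      ((hM.comp (tendsto_add_atTop_nat 1)).const_mul K).const_mul (2 * β)
  refine ⟨fun N => 2 * β * (K * M (N + 1)), hε, fun N δ hδ => ?_⟩
  have hflux : ∀ t ∈ Set.Ico 0 T, 2 * β * |(u t - stablePoint α β L) (N + 1)| *
      ∑ k ∈ range N, energyWeight α β r L (k + 1) *
        absTail N (u t - stablePoint α β L) (k + 1) ≤ 2 * β * (K * M (N + 1)) := by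
    intro t ht
    rw [mul_assoc (2 * β)]
    exact mul_le_mul_of_nonneg_left (abs_mul_sum_mul_absTail_le hr hr1
      (lyapunovWeight_nonneg hρ0 hρr hr1 hp hP) (lyapunovWeight_le hρ0 hρr hr1 hp hP)
      (hdev t (Set.Ico_subset_Icc_self ht)) (fun k => hB ⟨k, rfl⟩) N) (by positivity)
  have hcont : ∀ k, ContinuousOn (fun t => (u t - stablePoint α β L) k) (Set.Icc 0 T) :=
    fun k => ((hu.continuousOn k).mono Set.Icc_subset_Ici_self).sub continuousOn_const
  have hderiv : ∀ t ∈ Set.Ico 0 T, ∀ k, HasDerivWithinAt (fun s => (u s - stablePoint α β L) k)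
      (field α β L (u t) k) (Set.Ici t) t :=
    fun t ht k => (hu.hasDerivWithinAt ht.1 k).sub_const _
  have hgronwall := le_gronwallBound_of_liminf_deriv_right_le (continuousOn_energy hcont _ N)
    (fun t ht _ => (hasDerivWithinAt_energy (hderiv t ht) _ N).liminf_right_slope_le) hδ
    (fun t ht => (energyRightDeriv_field_le hα hβ hρr hr1 hP hL (hu.mem t ht.1) N).trans
      (add_le_add_right (hflux t ht) _))
    T (Set.right_mem_Icc.2 hT)
  rwa [sub_zero] at hgronwall

theorem IsSolution.summable_sq_div_pow_and_tsum_le (hu : IsSolution α β L u) (hα : 0 < α)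
    (hβ : 0 < β) (hρr : α / β < r) (hr1 : r < 1) (hP : ∀ k, rateProd (α / β) L k ≤ P)
    (hL : 1 ≤ L) (h0 : Summable fun k => (u 0 (k + 1) / r ^ (k + 1)) ^ 2) {T : ℝ} (hT : 0 ≤ T) :
    (Summable fun k => ((u T - stablePoint α β L) (k + 1) / r ^ (k + 1)) ^ 2) ∧
      ∑' k, ((u T - stablePoint α β L) (k + 1) / r ^ (k + 1)) ^ 2 ≤
        P / (1 - r) * (P / (1 - α / β / r) * ((1 - r) ^ 2)⁻¹) *
          Real.exp (-(2 * β * ((1 - α / β / r) * (1 - r) / P)) * T) *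
          ∑' k, ((u 0 - stablePoint α β L) (k + 1) / r ^ (k + 1)) ^ 2 := by
  obtain ⟨ε, hε, henergy⟩ :=
    hu.exists_energy_le_gronwallBound hα hβ hρr hr1 hP hL h0 hT
  have hρ0 : 0 < α / β := div_pos hα hβ
  have hc : 0 < 1 - α / β / r := sub_pos.2 ((div_lt_one (hρ0.trans hρr)).2 hρr)
  have hP0 : 0 < P := zero_lt_one.trans_le ((one_le_rateProd hρ0.le L 0).trans (hP 0))
  have hsum0 := summable_sq_sub_stablePoint_div_pow hα hβ hρr hr1 hL h0
  set γ := 2 * β * ((1 - α / β / r) * (1 - r) / P)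
  set E₀ := P / (1 - α / β / r) * ((1 - r) ^ 2)⁻¹ *
    ∑' k, ((u 0 - stablePoint α β L) (k + 1) / r ^ (k + 1)) ^ 2
  have hfinite : ∀ N, ∑ k ∈ range N, ((u T - stablePoint α β L) (k + 1) / r ^ (k + 1)) ^ 2 ≤
      P / (1 - r) * gronwallBound E₀ (-γ) (ε N) T := fun N =>
    (sum_sq_div_pow_le_energy hρ0 hρr hr1 hP N _).trans <| mul_le_mul_of_nonneg_left
      (henergy N E₀ <| (energy_le_sum_sq_div_pow hρ0 hρr hr1 hP N _).trans <|
        mul_le_mul_of_nonneg_left (hsum0.sum_le_tsum _ fun _ _ => sq_nonneg _) (by positivity))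
      (by positivity)
  have hlim : Tendsto (fun N => P / (1 - r) * gronwallBound E₀ (-γ) (ε N) T) atTop
      (𝓝 (P / (1 - r) * (E₀ * Real.exp (-γ * T)))) := by
    rw [← gronwallBound_ε0]
    exact (((gronwallBound_continuous_ε E₀ (-γ) T).tendsto 0).comp hε).const_mul _
  obtain ⟨B, hB⟩ := hlim.bddAbove_range
  have hsumT := summable_of_sum_range_le (fun _ => sq_nonneg _)
    fun N => (hfinite N).trans (hB ⟨N, rfl⟩)
  refine ⟨hsumT, (le_of_tendsto_of_tendsto' hsumT.hasSum.tendsto_sum_nat hlim hfinite).trans_eq ?_⟩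
  ring

theorem sq_mul_inv_geom_sq (r x : ℝ) (k : ℕ) : x ^ 2 * (geom (r ^ 2) k)⁻¹ = (x / r ^ k) ^ 2 := by
  rw [geom, ← pow_mul, mul_comm 2, pow_mul, div_pow, div_eq_mul_inv]

theorem sqSummable_geom_sq_iff {x : ℕ → ℝ} :
    SqSummable (geom (r ^ 2)) x ↔ Summable fun k => (x (k + 1) / r ^ (k + 1)) ^ 2 := by
  simp only [SqSummable, sq_mul_inv_geom_sq]

theorem L2norm_geom_sq (r : ℝ) (x : ℕ → ℝ) :
    L2norm (geom (r ^ 2)) x = Real.sqrt (∑' k, (x (k + 1) / r ^ (k + 1)) ^ 2) := by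
  simp only [L2norm, sq_mul_inv_geom_sq]

end Solution

end LoadBalancing

theorem theorem2p11_general (α β : ℝ) (hα : 0 < α) (hβ : 0 < β) (L : ℕ) (hL : 1 ≤ L)
    (θ : ℝ) (hρθ : (α / β) ^ 2 < θ) (hθ : θ < 1) :
    ∃ γ : ℝ, 0 < γ ∧ ∃ C : ℝ, ∀ u : ℝ → ℕ → ℝ,
      LoadBalancing.IsSolution α β L u →
      u 0 ∈ LoadBalancing.tailsL2 (LoadBalancing.geom θ) →
      ∀ t : ℝ, 0 ≤ t →
        u t - LoadBalancing.stablePoint α β L ∈ LoadBalancing.L2 (LoadBalancing.geom θ) ∧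
        LoadBalancing.L2norm (LoadBalancing.geom θ) (u t - LoadBalancing.stablePoint α β L) ≤
          Real.exp (-γ * t) * C *
            LoadBalancing.L2norm (LoadBalancing.geom θ)
              (u 0 - LoadBalancing.stablePoint α β L) := by
  open LoadBalancing in
  have hρ : 0 < α / β := div_pos hα hβ
  obtain ⟨r, hr, rfl⟩ : ∃ r, 0 ≤ r ∧ r ^ 2 = θ :=
    ⟨√θ, Real.sqrt_nonneg θ, Real.sq_sqrt ((sq_nonneg _).trans hρθ.le)⟩
  have hr1 : r < 1 := (sq_lt_one_iff₀ hr).1 hθ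
  have hρr : α / β < r := lt_of_pow_lt_pow_left₀ 2 hr hρθ
  have hr0 := hρ.trans hρr
  have hP := rateProd_le hρ.le (hρr.trans hr1) L
  set P := Real.exp (L * (1 - α / β)⁻¹)
  have hgap : 0 < 1 - α / β / r := sub_pos.2 ((div_lt_one hr0).2 hρr)
  refine ⟨β * ((1 - α / β / r) * (1 - r) / P), by positivity,
    √(P / (1 - r) * (P / (1 - α / β / r) * ((1 - r) ^ 2)⁻¹)), fun u hu hu0 t ht => ?_⟩
  obtain ⟨hsum, hle⟩ := hu.summable_sq_div_pow_and_tsum_le hα hβ hρr hr1 hP hL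
    (sqSummable_geom_sq_iff.1 hu0.2) ht
  refine ⟨⟨by rw [Pi.sub_apply, (hu.mem t ht).1, stablePoint_zero, sub_self],
    sqSummable_geom_sq_iff.2 hsum⟩, ?_⟩
  rw [L2norm_geom_sq, L2norm_geom_sq, mul_comm (Real.exp _)]
  refine (Real.sqrt_le_sqrt hle).trans_eq ?_
  rw [Real.sqrt_mul (by positivity), Real.sqrt_mul (by positivity), ← Real.exp_half]
  ring_nf

theorem theorem2p11 (α β : ℝ) (hα : 0 < α) (hβ : 0 < β) (L : ℕ) (hL : 1 ≤ L)
    (θ : ℝ) (hρθ : α / β ≤ θ) (hθ : θ < 1) :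
    ∃ γ : ℝ, 0 < γ ∧ ∃ C : ℝ, ∀ u : ℝ → ℕ → ℝ,
      LoadBalancing.IsSolution α β L u →
      u 0 ∈ LoadBalancing.tailsL2 (LoadBalancing.geom θ) →
      ∀ t : ℝ, 0 ≤ t →
        u t - LoadBalancing.stablePoint α β L ∈ LoadBalancing.L2 (LoadBalancing.geom θ) ∧
        LoadBalancing.L2norm (LoadBalancing.geom θ) (u t - LoadBalancing.stablePoint α β L) ≤
          Real.exp (-γ * t) * C *
            LoadBalancing.L2norm (LoadBalancing.geom θ)
              (u 0 - LoadBalancing.stablePoint α β L) :=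
  theorem2p11_general α β hα hβ L hL θ ((pow_lt_self_of_lt_one₀ (div_pos hα hβ)
    (hρθ.trans_lt hθ) one_lt_two).trans_le hρθ) hθ
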